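/- Let $T>0$ and let $X=(X_t)_{t\in[0,T]}$ be a Gaussian process with continuous paths on $(\Omega,\mathcal F,\mathbb P)$, with mean function $m(t)=\mathbb E[X_t]$, covariance function $R(t,s)=\mathrm{Cov}[X_t,X_s]$ and deterministic starting value $X_0=m(0)$ a.s. *Integrands and integrals.* Let $1_s$ be the indicator function of $[0,s)$ and let $\Lambda_T(X)$ be the Hilbert space obtained by completing $\mathrm{span}\{1_s: s\in[0,T]\}$ under $\langle\langle\cdot,\cdot\rangle\rangle$, the bilinear extension of $\langle\langle 1_s,1_u\rangle\rangle=R(s,u)$ (elements at distance zero being identified). The linear extension of $1_s\mapsto X_s-m(s)$ is an isometry $f\mapsto\int_0^T f\,d(X-m)$ of $\Lambda_T(X)$ into $L^2(\mathbb P)$. For a step function $f=\sum_k a_k1_{s_k}$ put $\int_0^T f\,dm=\sum_k a_k(m(s_k)-m(0))$; for $g\in\Lambda_T(X)$, $\int_0^T g\,dm$ denotes the limit $\lim_n\int_0^T f_n\,dm$ along a given sequence of step functions $f_n\to g$ in $\Lambda_T(X)$ for which this limit exists (it is $0$ if $m$ is constant), and $\int_0^T g\,dX:=\int_0^T g\,d(X-m)+\int_0^T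 g\,dm$. Let $N\ge 0$ and let $\mathbf g=(g_1,\dots,g_N)$ be such integrands, linearly independent in $\Lambda_T(X)$. Write $\langle\langle\mathbf g\rangle\rangle=\big[\langle\langle g_i,g_j\rangle\rangle\big]_{i,j}$ and $\langle\langle 1_t,\mathbf g\rangle\rangle=\big[\langle\langle 1_t,g_i\rangle\rangle\big]_i$. Then $\langle\langle g_i,g_j\rangle\rangle=\mathrm{Cov}\big[\int_0^Tg_i\,dX,\int_0^Tg_j\,dX\big]$, the matrix $\langle\langle\mathbf g\rangle\rangle$ is invertible, and the following hold. 1. For $\mathbf y\in\mathbb R^N$ put $$X^{\mathbf g;\mathbf y}_t = X_t-\langle\langle 1_t,\mathbf g\rangle\rangle^\top\langle\langle\mathbf g\rangle\rangle^{-1}\Big(\int_0^T\mathbf g\,dX-\mathbf y\Big),\qquad t\in[0,T].$$ This process has continuous paths, and it is a representation of the generalized Gaussian bridge: the map $\mathbf y\mapsto \mathbb P[X^{\mathbf g;\mathbf y}\in\cdot\,]$ is a regular conditional law, on $C([0,T])$ with its Borel $\sigma$-algebra, of $X$ given $\int_0^T\mathbf g\,dX=\mathbf y$. It is weakly continuous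 in $\mathbf y$; any other version of the regular conditional law agrees with it for Lebesgue-almost every $\mathbf y$, and any other weakly continuous version agrees with it for every $\mathbf y$. 2. For every $\mathbf y$, $X^{\mathbf g;\mathbf y}$ is a Gaussian process with $$\mathbb E[X^{\mathbf g;\mathbf y}_t]=m(t)-\langle\langle 1_t,\mathbf g\rangle\rangle^\top\langle\langle\mathbf g\rangle\rangle^{-1}\Big(\int_0^T\mathbf g\,dm-\mathbf y\Big),$$ $$\mathrm{Cov}[X^{\mathbf g;\mathbf y}_t,X^{\mathbf g;\mathbf y}_s]=\langle\langle 1_t,1_s\rangle\rangle-\langle\langle 1_t,\mathbf g\rangle\rangle^\top\langle\langle\mathbf g\rangle\rangle^{-1}\langle\langle 1_s,\mathbf g\rangle\rangle,\qquad \langle\langle 1_t,1_s\rangle\rangle=R(t,s).$$ -/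

import Mathlib

open MeasureTheory ProbabilityTheory Filter Topology Matrix

/-- The time interval `[0, T]`. -/
abbrev TimeInterval (T : ℝ) : Type := Set.Icc (0 : ℝ) T

/-- The path space `C([0, T])` with the topology of uniform convergence. -/
abbrev PathSpace (T : ℝ) : Type := C(TimeInterval T, ℝ)

/-- The path space carries its Borel σ-algebra. -/
instance PathSpace.instMeasurableSpace (T : ℝ) : MeasurableSpace (PathSpace T) := borel _

instance PathSpace.instBorelSpace (T : ℝ) : BorelSpace (PathSpace T) := ⟨rfl⟩

noncomputable section

/-! ### Step functions -/

/-- The indicator `1_s` of `[0, s)`, as a function on `[0, T]`. -/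
def stepInd {T : ℝ} (s : TimeInterval T) : TimeInterval T → ℝ :=
  Set.indicator (Set.Iio s) (fun _ => (1 : ℝ))

/-- The linear span of the indicators `1_s`, `s ∈ [0, T]`. -/
def stepSpace (T : ℝ) : Submodule ℝ (TimeInterval T → ℝ) :=
  Submodule.span ℝ (Set.range (stepInd (T := T)))

/-- The times `s ∈ (0, T]`. -/
abbrev PosTime (T : ℝ) : Type := {s : TimeInterval T // 0 < (s : ℝ)}

theorem stepInd_eq_zero {T : ℝ} {s : TimeInterval T} (hs : ¬ 0 < (s : ℝ)) : stepInd s = 0 := by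
  funext u
  have hu : ¬ u < s := fun h => hs (lt_of_le_of_lt u.2.1 h)
  simp [stepInd, hu]

theorem stepSpace_eq (T : ℝ) :
    Submodule.span ℝ (Set.range (fun s : PosTime T => stepInd s.1)) = stepSpace T := by
  apply le_antisymm
  · apply Submodule.span_mono
    rintro _ ⟨s, rfl⟩
    exact ⟨s.1, rfl⟩
  · refine Submodule.span_le.2 ?_
    rintro _ ⟨s, rfl⟩
    by_cases hs : 0 < (s : ℝ)
    · exact Submodule.subset_span ⟨⟨s, hs⟩, rfl⟩
    · rw [stepInd_eq_zero hs]
      exact Submodule.zero_mem _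

theorem linearIndependent_stepInd (T : ℝ) :
    LinearIndependent ℝ (fun s : PosTime T => stepInd s.1) := by
  classical
  rw [linearIndependent_iff]
  intro l hl
  by_contra hne
  have hsupp : l.support.Nonempty := Finsupp.support_nonempty_iff.2 hne
  set M := l.support.max' hsupp with hM
  have hMmem : M ∈ l.support := Finset.max'_mem _ _
  have hT : (0 : ℝ) ≤ T := le_trans M.1.2.1 M.1.2.2
  obtain ⟨u, huM, hu⟩ : ∃ u : TimeInterval T, u < M.1 ∧
      ∀ s ∈ l.support, s ≠ M → s.1 ≤ u := by
    by_cases h : (l.support.erase M).Nonempty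
    · refine ⟨((l.support.erase M).max' h).1, ?_, ?_⟩
      · have h1 := Finset.max'_mem _ h
        have h2 := Finset.le_max' _ _ (Finset.mem_of_mem_erase h1)
        exact lt_of_le_of_ne h2 (fun e => Finset.ne_of_mem_erase h1 (Subtype.ext e))
      · intro s hs hsM
        exact Finset.le_max' _ _ (Finset.mem_erase.2 ⟨hsM, hs⟩)
    · refine ⟨⟨0, le_refl _, hT⟩, M.2, ?_⟩
      intro s hs hsM
      exact absurd ⟨s, Finset.mem_erase.2 ⟨hsM, hs⟩⟩ h
  have hev := congrFun hl u
  rw [Finsupp.linearCombination_apply, Finsupp.sum, Finset.sum_apply,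
    Finset.sum_eq_single M] at hev
  · have h1 : l M = 0 := by simpa [stepInd, huM] using hev
    exact (Finsupp.mem_support_iff.1 hMmem) h1
  · intro s hs hsM
    simp [stepInd, hu s hs hsM]
  · intro h
    exact absurd hMmem h

/-- The basis of the space of step functions formed by `1_s`, `s ∈ (0, T]` (note `1_0 = 0`). -/
def stepBasis (T : ℝ) : Module.Basis (PosTime T) ℝ (stepSpace T) :=
  (Module.Basis.span (linearIndependent_stepInd T)).map (LinearEquiv.ofEq _ _ (stepSpace_eq T))

/-- For a function `x` on `[0, T]` that vanishes at `0`, the integral `∫₀ᵀ f dx` of step functions: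
the linear extension of `1_s ↦ x s`. -/
def stepIntegral {T : ℝ} {E : Type*} [AddCommGroup E] [Module ℝ E] (x : TimeInterval T → E) :
    stepSpace T →ₗ[ℝ] E :=
  (stepBasis T).constr ℝ (fun s => x s.1)

theorem stepInd_mem {T : ℝ} (s : TimeInterval T) : stepInd s ∈ stepSpace T :=
  Submodule.subset_span ⟨s, rfl⟩

theorem stepBasis_apply {T : ℝ} (s : PosTime T) :
    stepBasis T s = ⟨stepInd s.1, stepInd_mem s.1⟩ := by
  apply Subtype.ext
  simp [stepBasis]

theorem stepIntegral_stepInd {T : ℝ} {E : Type*} [AddCommGroup E] [Module ℝ E]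
    (x : TimeInterval T → E) (hx : ∀ s : TimeInterval T, (s : ℝ) = 0 → x s = 0)
    (s : TimeInterval T) : stepIntegral x ⟨stepInd s, stepInd_mem s⟩ = x s := by
  by_cases hs : 0 < (s : ℝ)
  · have h := (stepBasis T).constr_basis ℝ (fun s => x s.1) ⟨s, hs⟩
    rw [stepBasis_apply] at h
    exact h
  · have h0 : (⟨stepInd s, stepInd_mem s⟩ : stepSpace T) = 0 :=
      Subtype.ext (stepInd_eq_zero hs)
    rw [h0, map_zero, hx s (le_antisymm (not_lt.1 hs) s.2.1)]

/-! ### Continuous Gaussian processes -/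

/-- A continuous Gaussian process `X = (X_t)_{t ∈ [0, T]}` on `(Ω, P)` with deterministic starting
value `X_0 = m(0)`. Since all finite-dimensional laws are Gaussian, `P` is a probability measure. -/
structure ContinuousGaussian (T : ℝ) {Ω : Type*} [MeasurableSpace Ω] (P : Measure Ω) where
  /-- The random path. -/
  path : Ω → PathSpace T
  measurable_path : Measurable path
  gaussian : IsGaussianProcess (fun (t : TimeInterval T) (ω : Ω) => path ω t) P
  start : ∀ t : TimeInterval T, (t : ℝ) = 0 → ∀ᵐ ω ∂P, path ω t = ∫ ω', path ω' t ∂P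

namespace ContinuousGaussian

variable {T : ℝ} {Ω : Type*} [MeasurableSpace Ω] {P : Measure Ω}

/-- The mean function `m(t) = E[X_t]`. -/
def mean (X : ContinuousGaussian T P) (t : TimeInterval T) : ℝ := ∫ ω, X.path ω t ∂P

/-- The covariance function `R(t, s) = Cov[X_t, X_s]`. -/
def covar (X : ContinuousGaussian T P) (t s : TimeInterval T) : ℝ :=
  cov[fun ω => X.path ω t, fun ω => X.path ω s; P]

theorem memLp_path (X : ContinuousGaussian T P) (t : TimeInterval T) :
    MemLp (fun ω => X.path ω t) 2 P :=
  (X.gaussian.hasGaussianLaw_eval t).memLp_two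

theorem memLp_centered (X : ContinuousGaussian T P) (t : TimeInterval T) :
    MemLp (fun ω => X.path ω t - X.mean t) 2 P := by
  have := X.gaussian.isProbabilityMeasure
  exact (X.memLp_path t).sub (memLp_const _)

/-- The centered random variable `X_t - m(t)` as an element of `L²(P)`. -/
def centered (X : ContinuousGaussian T P) (t : TimeInterval T) : Lp ℝ 2 P :=
  (X.memLp_centered t).toLp

theorem inner_centered (X : ContinuousGaussian T P) (t s : TimeInterval T) :
    inner ℝ (X.centered t) (X.centered s) = X.covar t s := by
  rw [L2.inner_def, covar, covariance]
  apply integral_congr_ae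
  filter_upwards [(X.memLp_centered t).coeFn_toLp, (X.memLp_centered s).coeFn_toLp] with ω h1 h2
  rw [centered, centered, h1, h2]
  exact mul_comm _ _

theorem centered_zero (X : ContinuousGaussian T P) (t : TimeInterval T) (ht : (t : ℝ) = 0) :
    X.centered t = 0 := by
  rw [Lp.eq_zero_iff_ae_eq_zero]
  refine (X.memLp_centered t).coeFn_toLp.trans ?_
  filter_upwards [X.start t ht] with ω h
  simp [mean, h]

/-- The bilinear form on step functions extended from `⟨⟨1_s, 1_u⟩⟩ = R(s, u)`. -/
def stepInner (X : ContinuousGaussian T P) (f h : stepSpace T) : ℝ :=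
  stepIntegral (fun s => stepIntegral (fun u => X.covar s u) h) f

theorem stepInner_eq (X : ContinuousGaussian T P) (f h : stepSpace T) :
    X.stepInner f h = inner ℝ (stepIntegral X.centered f) (stepIntegral X.centered h) := by
  have h1 : ∀ s, stepIntegral (fun u => X.covar s u) h =
      inner ℝ (X.centered s) (stepIntegral X.centered h) := by
    intro s
    simp only [stepIntegral, Module.Basis.constr_apply, Finsupp.sum, inner_sum, inner_smul_right,
      inner_centered, smul_eq_mul]
  unfold stepInner
  simp only [h1]
  simp only [stepIntegral, Module.Basis.constr_apply, Finsupp.sum, sum_inner, inner_smul_left,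
    smul_eq_mul]
  simp

theorem stepInner_comm (X : ContinuousGaussian T P) (f h : stepSpace T) :
    X.stepInner h f = X.stepInner f h := by
  rw [stepInner_eq, stepInner_eq, real_inner_comm]

theorem stepInner_self_nonneg (X : ContinuousGaussian T P) (f : stepSpace T) :
    0 ≤ X.stepInner f f := by
  rw [stepInner_eq]
  exact real_inner_self_nonneg

/-- The space of step functions, to be equipped with the semi-inner product defined by `R`. -/
def StepFun (_X : ContinuousGaussian T P) : Type := stepSpace T

instance (X : ContinuousGaussian T P) : AddCommGroup X.StepFun :=
  inferInstanceAs (AddCommGroup (stepSpace T))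

instance (X : ContinuousGaussian T P) : Module ℝ X.StepFun :=
  inferInstanceAs (Module ℝ (stepSpace T))

/-- The semi-inner product `⟨⟨·, ·⟩⟩` on step functions. -/
abbrev stepCore (X : ContinuousGaussian T P) : PreInnerProductSpace.Core ℝ X.StepFun where
  inner f h := X.stepInner f h
  conj_inner_symm f h := X.stepInner_comm f h
  re_inner_nonneg f := X.stepInner_self_nonneg f
  add_left f g h :=
    map_add (stepIntegral (fun s => stepIntegral (fun u => X.covar s u) h)) f g
  smul_left f g r :=
    map_smul (stepIntegral (fun s => stepIntegral (fun u => X.covar s u) g)) r f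

instance (X : ContinuousGaussian T P) : SeminormedAddCommGroup X.StepFun :=
  @InnerProductSpace.Core.toSeminormedAddCommGroup ℝ X.StepFun _ _ _ X.stepCore

instance (X : ContinuousGaussian T P) : InnerProductSpace ℝ X.StepFun :=
  InnerProductSpace.ofCore X.stepCore

/-- The abstract Wiener integrand space `Λ_T(X)`: the completion of the space of step functions
under `⟨⟨·, ·⟩⟩` (step functions at distance zero being identified). Its inner product is the
extension of `⟨⟨·, ·⟩⟩`. -/
abbrev Lam (X : ContinuousGaussian T P) : Type := UniformSpace.Completion X.StepFun

/-- A step function as an element of `Λ_T(X)`. -/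
def ofStep (X : ContinuousGaussian T P) (f : stepSpace T) : X.Lam :=
  ((show X.StepFun from f : X.StepFun) : UniformSpace.Completion X.StepFun)

/-- The indicator `1_t` as an element of `Λ_T(X)`. -/
def ind (X : ContinuousGaussian T P) (t : TimeInterval T) : X.Lam :=
  X.ofStep ⟨stepInd t, stepInd_mem t⟩

theorem inner_ofStep (X : ContinuousGaussian T P) (f h : stepSpace T) :
    inner ℝ (X.ofStep f) (X.ofStep h) = X.stepInner f h :=
  UniformSpace.Completion.inner_coe _ _

theorem inner_ind (X : ContinuousGaussian T P) (t s : TimeInterval T) :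
    inner ℝ (X.ind t) (X.ind s) = X.covar t s := by
  rw [ind, ind, inner_ofStep, stepInner_eq, stepIntegral_stepInd _ X.centered_zero,
    stepIntegral_stepInd _ X.centered_zero, inner_centered]

/-- The step-function integral of the centered process, as a linear map on `StepFun`. -/
def stepWiener (X : ContinuousGaussian T P) : X.StepFun →ₗ[ℝ] Lp ℝ 2 P :=
  stepIntegral X.centered

theorem norm_stepWiener (X : ContinuousGaussian T P) (f : X.StepFun) :
    ‖X.stepWiener f‖ = ‖f‖ := by
  have h : ‖X.stepWiener f‖ ^ 2 = ‖f‖ ^ 2 := by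
    rw [← real_inner_self_eq_norm_sq, ← real_inner_self_eq_norm_sq]
    exact (X.stepInner_eq f f).symm
  exact (sq_eq_sq₀ (norm_nonneg _) (norm_nonneg _)).1 h

/-- The abstract Wiener integral `f ↦ ∫₀ᵀ f d(X - m)` with respect to the centered process: the
continuous linear extension to `Λ_T(X)` of `1_s ↦ X_s - m(s)`. -/
def wienerIntegral (X : ContinuousGaussian T P) : X.Lam →L[ℝ] Lp ℝ 2 P :=
  X.stepWiener.extendOfNorm
    (UniformSpace.Completion.toComplL (𝕜 := ℝ) (E := X.StepFun)).toLinearMap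

theorem wienerIntegral_ofStep (X : ContinuousGaussian T P) (f : stepSpace T) :
    X.wienerIntegral (X.ofStep f) = stepIntegral X.centered f := by
  refine LinearMap.extendOfNorm_eq (f := X.stepWiener)
    (e := (UniformSpace.Completion.toComplL (𝕜 := ℝ) (E := X.StepFun)).toLinearMap)
    UniformSpace.Completion.denseRange_coe ⟨1, fun x => ?_⟩ f
  rw [norm_stepWiener, one_mul]
  exact (UniformSpace.Completion.norm_coe x).ge

theorem wienerIntegral_ind (X : ContinuousGaussian T P) (s : TimeInterval T) :
    X.wienerIntegral (X.ind s) = X.centered s := by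
  rw [ind, wienerIntegral_ofStep, stepIntegral_stepInd _ X.centered_zero]

theorem norm_wienerIntegral (X : ContinuousGaussian T P) (f : X.Lam) :
    ‖X.wienerIntegral f‖ = ‖f‖ := by
  induction f using UniformSpace.Completion.induction_on with
  | hp => exact isClosed_eq (by fun_prop) (by fun_prop)
  | ih a =>
    rw [UniformSpace.Completion.norm_coe, ← norm_stepWiener]
    exact congrArg norm (X.wienerIntegral_ofStep a)

/-- The Stieltjes integral `∫₀ᵀ f dm` of a step function, i.e. the linear extension of
`1_s ↦ m(s) - m(0)`. -/
def stepMeanIntegral (X : ContinuousGaussian T P) : stepSpace T →ₗ[ℝ] ℝ :=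
  stepIntegral (fun s => X.mean s - X.mean ⟨0, le_refl 0, s.2.1.trans s.2.2⟩)

theorem stepMeanIntegral_stepInd (X : ContinuousGaussian T P) (s : TimeInterval T) :
    X.stepMeanIntegral ⟨stepInd s, stepInd_mem s⟩ =
      X.mean s - X.mean ⟨0, le_refl 0, s.2.1.trans s.2.2⟩ := by
  refine stepIntegral_stepInd _ (fun t ht => ?_) s
  have : t = ⟨0, le_refl 0, t.2.1.trans t.2.2⟩ := Subtype.ext ht
  rw [← this, sub_self]

/-- An integrand for the (possibly non-centered) process `X`: an element `g` of `Λ_T(X)` for which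
`∫₀ᵀ g dm` is given, as the limit of `∫₀ᵀ f_n dm` along some sequence of step functions `f_n` that
converges to `g` in `Λ_T(X)`. If `X` is centered this is just an element of `Λ_T(X)`, and the
integral with respect to the mean is zero. -/
structure Integrand (X : ContinuousGaussian T P) where
  /-- The element `g` of `Λ_T(X)`. -/
  elem : X.Lam
  /-- The value of `∫₀ᵀ g dm`. -/
  meanIntegral : ℝ
  exists_approx : ∃ f : ℕ → stepSpace T,
    Tendsto (fun n => X.ofStep (f n)) atTop (𝓝 elem) ∧
    Tendsto (fun n => X.stepMeanIntegral (f n)) atTop (𝓝 meanIntegral)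

variable {N : ℕ}

/-- The vector `∫₀ᵀ g dm`. -/
def meanVec (X : ContinuousGaussian T P) (g : Fin N → X.Integrand) : Fin N → ℝ :=
  fun i => (g i).meanIntegral

/-- The random vector `∫₀ᵀ g dX = ∫₀ᵀ g d(X - m) + ∫₀ᵀ g dm`. -/
def integralVec (X : ContinuousGaussian T P) (g : Fin N → X.Integrand) (ω : Ω) :
    Fin N → ℝ :=
  fun i => X.wienerIntegral (g i).elem ω + (g i).meanIntegral

/-- The matrix `⟨⟨g⟩⟩` with entries `⟨⟨g_i, g_j⟩⟩`. -/
def gramMatrix (X : ContinuousGaussian T P) (g : Fin N → X.Integrand) :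
    Matrix (Fin N) (Fin N) ℝ :=
  Matrix.of fun i j => inner ℝ (g i).elem (g j).elem

/-- The vector `⟨⟨1_t, g⟩⟩`. -/
def indVec (X : ContinuousGaussian T P) (g : Fin N → X.Integrand) (t : TimeInterval T) :
    Fin N → ℝ :=
  fun i => inner ℝ (X.ind t) (g i).elem

/-- The orthogonal representation
`X_t - ⟨⟨1_t, g⟩⟩ᵀ ⟨⟨g⟩⟩⁻¹ (∫₀ᵀ g dX - y)`. -/
def orthoBridge (X : ContinuousGaussian T P) (g : Fin N → X.Integrand) (y : Fin N → ℝ)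
    (t : TimeInterval T) (ω : Ω) : ℝ :=
  X.path ω t - X.indVec g t ⬝ᵥ ((X.gramMatrix g)⁻¹ *ᵥ (X.integralVec g ω - y))

/-- `κ` is a version of the family of generalized bridge measures
`y ↦ P[X ∈ · | ∫₀ᵀ g dX = y]`, i.e. of the regular conditional law of the path of `X` given
`∫₀ᵀ g dX`. -/
def IsBridgeMeasure (X : ContinuousGaussian T P) (g : Fin N → X.Integrand)
    (κ : Kernel (Fin N → ℝ) (PathSpace T)) : Prop :=
  IsMarkovKernel κ ∧ HasCondDistrib X.path (X.integralVec g) κ P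

/-- The family of measures `κ y` depends weakly continuously on `y`. -/
def IsWeaklyContinuous (κ : Kernel (Fin N → ℝ) (PathSpace T)) : Prop :=
  ∀ φ : BoundedContinuousFunction (PathSpace T) ℝ, Continuous fun y => ∫ x, φ x ∂(κ y)

end ContinuousGaussian

end

/-! The theorem is orthogonal projection in `Λ_T(X)`, carried over to `L²(P)` by the Wiener
isometry. Split `1_t` into its projection on the span of `g` and a residual. The bridge value at `t`
is then almost surely the Wiener integral of the residual plus a constant, and `y` occurs only in
that constant (`orthoBridge_ae_eq`). Wiener integrals are centered Gaussian with variance `‖f‖²`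
(`map_wienerIntegral`), so Gaussianity, mean and covariance can be read off.

The residuals are orthogonal to `g`. Hence the bridge path for `y = 0` is uncorrelated with the
jointly Gaussian vector `∫ g dX`, and so independent of it (`indepFun_integralVec_bridgePath`). Thus
`X` is a drift determined by the observed vector plus an independent path, and freezing the vector
at `y` gives the conditional law (`hasCondDistrib_of_indepFun`). The drift is a continuous path
because `t ↦ 1_t` is continuous into `Λ_T(X)` (`continuous_ind`). It depends continuously on `y`,
which gives weak continuity.

For uniqueness, a conditional law is determined up to null sets of the law of `∫ g dX`. That law
dominates Lebesgue measure (`volume_absolutelyContinuous_map_integralVec`), and weakly continuous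
families that agree Lebesgue-almost everywhere agree everywhere. -/

/-! ### Gaussian shifts and `L²`-continuity of characteristic functions -/

theorem ProbabilityTheory.HasGaussianLaw.add_const {Ω E : Type*} [MeasurableSpace Ω]
    [NormedAddCommGroup E] [NormedSpace ℝ E] [MeasurableSpace E] [BorelSpace E]
    [SecondCountableTopology E] [CompleteSpace E] {Y : Ω → E} {P : Measure Ω}
    (hY : HasGaussianLaw Y P) (c : E) : HasGaussianLaw (fun ω => Y ω + c) P := by
  have := hY.isGaussian_map
  constructor
  rw [show (fun ω => Y ω + c) = (fun x => x + c) ∘ Y from rfl,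
    ← AEMeasurable.map_map_of_aemeasurable (by fun_prop) hY.aemeasurable]
  infer_instance

theorem MeasureTheory.L2.integral_norm_le {Ω : Type*} [MeasurableSpace Ω] {P : Measure Ω}
    [IsProbabilityMeasure P] (h : Lp ℝ 2 P) : ∫ ω, ‖h ω‖ ∂P ≤ ‖h‖ := by
  rw [Lp.norm_def, integral_norm_eq_lintegral_enorm (Lp.aestronglyMeasurable h),
    ← eLpNorm_one_eq_lintegral_enorm]
  exact ENNReal.toReal_mono (Lp.eLpNorm_ne_top h)
    (eLpNorm_le_eLpNorm_of_exponent_le (by norm_num) (Lp.aestronglyMeasurable h))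

theorem Complex.norm_exp_ofReal_mul_I_sub_le (a b : ℝ) :
    ‖Complex.exp (a * Complex.I) - Complex.exp (b * Complex.I)‖ ≤ ‖a - b‖ := by
  have h : Complex.exp (a * Complex.I) - Complex.exp (b * Complex.I) =
      Complex.exp (b * Complex.I) * (Complex.exp (Complex.I * ((a - b : ℝ) : ℂ)) - 1) := by
    rw [mul_sub, ← Complex.exp_add, mul_one]
    congr 2
    push_cast
    ring
  rw [h, norm_mul, Complex.norm_exp_ofReal_mul_I, one_mul]
  exact Real.norm_exp_I_mul_ofReal_sub_one_le

/-- Lets laws pass from step functions to their `L²` limits. The map is Lipschitz with constant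
`|t|`, since `a ↦ exp(ia)` is 1-Lipschitz and the `L¹` norm is at most the `L²` norm. -/
theorem MeasureTheory.L2.continuous_integral_exp {Ω : Type*} [MeasurableSpace Ω] {P : Measure Ω}
    [IsProbabilityMeasure P] (t : ℝ) :
    Continuous fun h : Lp ℝ 2 P => ∫ ω, Complex.exp (((t * h ω : ℝ) : ℂ) * Complex.I) ∂P := by
  have hint : ∀ h : Lp ℝ 2 P,
      Integrable (fun ω => Complex.exp (((t * h ω : ℝ) : ℂ) * Complex.I)) P := by
    intro h
    refine Integrable.of_bound (C := 1) ?_ (ae_of_all _ fun ω => ?_)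
    · have := (Lp.stronglyMeasurable h).measurable
      exact Measurable.aestronglyMeasurable (by fun_prop)
    · rw [Complex.norm_exp_ofReal_mul_I]
  refine (LipschitzWith.of_dist_le_mul (K := ‖t‖₊) fun h k => ?_).continuous
  rw [dist_eq_norm, dist_eq_norm, ← integral_sub (hint h) (hint k)]
  calc _ ≤ ∫ ω, ‖t‖ * ‖(h - k : Lp ℝ 2 P) ω‖ ∂P := by
        refine norm_integral_le_of_norm_le ?_ ?_
        · exact (((Lp.memLp (h - k)).integrable (by norm_num)).norm.const_mul _)
        · filter_upwards [Lp.coeFn_sub h k] with ω hω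
          rw [hω, Pi.sub_apply, ← norm_mul, mul_sub]
          exact Complex.norm_exp_ofReal_mul_I_sub_le _ _
    _ ≤ ‖t‖ * ‖h - k‖ := by
        rw [integral_const_mul]
        exact mul_le_mul_of_nonneg_left (L2.integral_norm_le _) (norm_nonneg _)

/-! ### Laws and covariances of Wiener integrals -/

namespace ContinuousGaussian

variable {T : ℝ} {Ω : Type*} [MeasurableSpace Ω] {P : Measure Ω}

theorem integral_centered (X : ContinuousGaussian T P) (t : TimeInterval T) :
    ∫ ω, X.centered t ω ∂P = 0 := by
  have := X.gaussian.isProbabilityMeasure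
  rw [centered, integral_congr_ae (X.memLp_centered t).coeFn_toLp,
    integral_sub ((X.memLp_path t).integrable (by norm_num)) (integrable_const _)]
  simp [mean]

theorem stepIntegral_centered_eq (X : ContinuousGaussian T P) (f : stepSpace T) :
    stepIntegral X.centered f = ∑ s ∈ ((stepBasis T).repr f).support,
      (stepBasis T).repr f s • X.centered s.1 := by
  rw [stepIntegral, Module.Basis.constr_apply, Finsupp.sum]

theorem coeFn_stepIntegral_centered (X : ContinuousGaussian T P) (f : stepSpace T) :
    stepIntegral X.centered f =ᵐ[P] fun ω => ∑ s ∈ ((stepBasis T).repr f).support,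
      (stepBasis T).repr f s * X.centered s.1 ω := by
  rw [stepIntegral_centered_eq]
  have h : ∀ᵐ ω ∂P, ∀ s ∈ ((stepBasis T).repr f).support,
      ((stepBasis T).repr f s • X.centered s.1 : Lp ℝ 2 P) ω =
        (stepBasis T).repr f s * X.centered s.1 ω := by
    exact (ae_ball_iff (Finset.countable_toSet _)).2 fun s _ => Lp.coeFn_smul _ _
  filter_upwards [h, Lp.coeFn_finsetSum ((stepBasis T).repr f).support
    (fun s => (stepBasis T).repr f s • X.centered s.1)] with ω h1 h2
  rw [h2, Finset.sum_apply]
  exact Finset.sum_congr rfl h1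

theorem integral_stepIntegral_centered (X : ContinuousGaussian T P) (f : stepSpace T) :
    ∫ ω, stepIntegral X.centered f ω ∂P = 0 := by
  have := X.gaussian.isProbabilityMeasure
  rw [integral_congr_ae (X.coeFn_stepIntegral_centered f), integral_finsetSum]
  · simp [integral_const_mul, integral_centered]
  · exact fun s _ => ((Lp.memLp (X.centered s.1)).integrable (by norm_num)).const_mul _

theorem hasGaussianLaw_stepIntegral_centered (X : ContinuousGaussian T P) (f : stepSpace T) :
    HasGaussianLaw (stepIntegral X.centered f) P := by
  have := X.gaussian.isProbabilityMeasure
  set c := (stepBasis T).repr f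
  have h := (((X.gaussian.comp_right (fun s : PosTime T => s.1)).smul c).hasGaussianLaw_fun_sum
    (I := c.support)).add_const (-∑ s ∈ c.support, c s * X.mean s.1)
  refine h.congr ?_
  have h' : ∀ᵐ ω ∂P, ∀ s ∈ c.support, X.centered s.1 ω = X.path ω s.1 - X.mean s.1 :=
    (ae_ball_iff (Finset.countable_toSet _)).2 fun s _ => (X.memLp_centered s.1).coeFn_toLp
  filter_upwards [h', X.coeFn_stepIntegral_centered f] with ω h1 h2
  rw [h2, ← sub_eq_add_neg, ← Finset.sum_sub_distrib]
  refine Finset.sum_congr rfl fun s hs => ?_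
  rw [h1 s hs]
  simp [c, mul_sub]

/-- The law of the Wiener integral of `f` is the centered Gaussian law with variance `‖f‖²`. -/
theorem map_wienerIntegral (X : ContinuousGaussian T P) (f : X.Lam) :
    P.map (X.wienerIntegral f) = gaussianReal 0 (‖f‖₊ ^ 2) := by
  have := X.gaussian.isProbabilityMeasure
  have hm : ∀ f, AEMeasurable (X.wienerIntegral f) P := fun f =>
    (Lp.stronglyMeasurable _).measurable.aemeasurable
  have hp : IsProbabilityMeasure (P.map (X.wienerIntegral f)) :=
    Measure.isProbabilityMeasure_map (hm f)
  have hc : ∀ (f : X.Lam) (t : ℝ), charFun (P.map (X.wienerIntegral f)) t =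
      ∫ ω, Complex.exp (((t * X.wienerIntegral f ω : ℝ) : ℂ) * Complex.I) ∂P := by
    intro f t
    rw [charFun_apply_real, integral_map (hm f) (by fun_prop)]
    simp
  apply Measure.ext_of_charFun
  clear hp
  ext t
  rw [hc, charFun_gaussianReal]
  -- Both characteristic functions are continuous in `f`, so it suffices to compare them on the
  -- dense set of step functions.
  induction f using UniformSpace.Completion.induction_on with
  | hp =>
    have h1 := (L2.continuous_integral_exp (P := P) t).comp X.wienerIntegral.continuous
    have h2 : Continuous fun f : X.Lam => Complex.exp (t * (0 : ℝ) * Complex.I -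
        ((‖f‖₊ ^ 2 : NNReal) : ℝ) * t ^ 2 / 2) := by fun_prop
    exact isClosed_eq h1 h2
  | ih f =>
    have hf : X.wienerIntegral f = stepIntegral X.centered f := X.wienerIntegral_ofStep f
    have hv : Var[stepIntegral X.centered f; P] = ‖(f : X.Lam)‖ ^ 2 := by
      rw [variance_of_integral_eq_zero (hf ▸ hm f) (X.integral_stepIntegral_centered f),
        ← X.norm_wienerIntegral, ← real_inner_self_eq_norm_sq, L2.inner_def, hf]
      simp [pow_two]
    rw [← charFun_gaussianReal, ← hc, hf,
      (X.hasGaussianLaw_stepIntegral_centered f).map_eq_gaussianReal,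
      X.integral_stepIntegral_centered f, hv]
    congr 1
    congr 1
    ext
    simp

theorem hasGaussianLaw_wienerIntegral (X : ContinuousGaussian T P) (f : X.Lam) :
    HasGaussianLaw (X.wienerIntegral f) P :=
  ⟨by rw [map_wienerIntegral]; infer_instance⟩

theorem integral_wienerIntegral (X : ContinuousGaussian T P) (f : X.Lam) :
    ∫ ω, X.wienerIntegral f ω ∂P = 0 := by
  have h : ∫ x, x ∂(P.map (X.wienerIntegral f)) = 0 := by
    rw [map_wienerIntegral, integral_id_gaussianReal]
  rwa [integral_map (Lp.stronglyMeasurable _).measurable.aemeasurable (by fun_prop)] at h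

theorem inner_wienerIntegral (X : ContinuousGaussian T P) (f h : X.Lam) :
    inner ℝ (X.wienerIntegral f) (X.wienerIntegral h) = inner ℝ f h :=
  (LinearIsometry.mk X.wienerIntegral.toLinearMap X.norm_wienerIntegral).inner_map_map f h

theorem covariance_wienerIntegral (X : ContinuousGaussian T P) (f h : X.Lam) :
    cov[X.wienerIntegral f, X.wienerIntegral h; P] = inner ℝ f h := by
  rw [← inner_wienerIntegral, covariance, integral_wienerIntegral, integral_wienerIntegral,
    L2.inner_def]
  simp [mul_comm]

/-! ### Processes that are Wiener integrals plus constants -/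

section Affine

variable {S : Type*} {Y : S → Ω → ℝ}

theorem hasGaussianLaw_of_ae_eq (X : ContinuousGaussian T P) {Z : Ω → ℝ} {f : X.Lam} {c : ℝ}
    (h : Z =ᵐ[P] fun ω => X.wienerIntegral f ω + c) : HasGaussianLaw Z P :=
  ((X.hasGaussianLaw_wienerIntegral f).add_const c).congr h.symm

/-- A process whose values are Wiener integrals up to constants is Gaussian. -/
theorem isGaussianProcess_of_ae_eq (X : ContinuousGaussian T P) {f : S → X.Lam} {c : S → ℝ}
    (h : ∀ s, Y s =ᵐ[P] fun ω => X.wienerIntegral (f s) ω + c s) : IsGaussianProcess Y P := by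
  classical
  have := X.gaussian.isProbabilityMeasure
  have hm : ∀ s, AEMeasurable (Y s) P := fun s => (X.hasGaussianLaw_of_ae_eq (h s)).aemeasurable
  -- Cramér–Wold: a linear functional of a finite marginal is again a Wiener integral plus a
  -- constant, with integrand and constant combined using the coefficients of `L`.
  refine ⟨fun I => ⟨isGaussian_of_isGaussian_map fun L => ?_⟩⟩
  have hI : AEMeasurable (fun ω => I.restrict (Y · ω)) P := aemeasurable_pi_lambda _ fun s => hm s
  rw [AEMeasurable.map_map_of_aemeasurable (by fun_prop) hI]
  refine (X.hasGaussianLaw_of_ae_eq (Z := L ∘ fun ω => I.restrict (Y · ω))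
    (f := ∑ s : I, L (Pi.single s 1) • f s) (c := ∑ s : I, L (Pi.single s 1) * c s)
    ?_).isGaussian_map
  have h1 : ∀ᵐ ω ∂P, ∀ s : I, Y s ω = X.wienerIntegral (f s) ω + c s :=
    ae_all_iff.2 fun s => h s
  have h2 : ∀ᵐ ω ∂P, ∀ s : I, (L (Pi.single s 1) • X.wienerIntegral (f s) : Lp ℝ 2 P) ω =
      L (Pi.single s 1) * X.wienerIntegral (f s) ω :=
    ae_all_iff.2 fun s => Lp.coeFn_smul _ _
  simp only [map_sum, map_smul]
  filter_upwards [h1, h2, Lp.coeFn_finsetSum Finset.univ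
    (fun s : I => L (Pi.single s 1) • X.wienerIntegral (f s))] with ω h1 h2 h3
  rw [h3, Finset.sum_apply, ← Finset.sum_add_distrib, Function.comp_apply]
  refine (L.toLinearMap.pi_apply_eq_sum_univ _).trans ?_
  refine Finset.sum_congr rfl fun s _ => ?_
  rw [h2, ← mul_add, ← h1, smul_eq_mul, mul_comm]
  congr 1
  refine congrArg L (funext fun j => ?_)
  simp [Pi.single_apply, eq_comm]

theorem integral_of_ae_eq (X : ContinuousGaussian T P) {Z : Ω → ℝ} {f : X.Lam} {c : ℝ}
    (h : Z =ᵐ[P] fun ω => X.wienerIntegral f ω + c) : ∫ ω, Z ω ∂P = c := by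
  have := X.gaussian.isProbabilityMeasure
  rw [integral_congr_ae h, integral_add ((Lp.memLp _).integrable (by norm_num))
    (integrable_const _), integral_wienerIntegral]
  simp

theorem covariance_of_ae_eq (X : ContinuousGaussian T P) {Z Z' : Ω → ℝ} {f f' : X.Lam} {c c' : ℝ}
    (h : Z =ᵐ[P] fun ω => X.wienerIntegral f ω + c)
    (h' : Z' =ᵐ[P] fun ω => X.wienerIntegral f' ω + c') : cov[Z, Z'; P] = inner ℝ f f' := by
  rw [← covariance_wienerIntegral, covariance, covariance, X.integral_of_ae_eq h,
    X.integral_of_ae_eq h', integral_wienerIntegral, integral_wienerIntegral]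
  apply integral_congr_ae
  filter_upwards [h, h'] with ω h1 h2
  rw [h1, h2]
  ring

end Affine

/-! ### Mean-square continuity of the process -/

theorem path_ae_eq (X : ContinuousGaussian T P) (t : TimeInterval T) :
    (fun ω => X.path ω t) =ᵐ[P] fun ω => X.wienerIntegral (X.ind t) ω + X.mean t := by
  rw [wienerIntegral_ind]
  filter_upwards [(X.memLp_centered t).coeFn_toLp] with ω h
  rw [centered, h]
  ring

/-- Path continuity alone gives only pointwise convergence of `X_s` to `X_t`; Gaussianity upgrades
it to `L²`. The characteristic function of `X_s - X_t` at `1` has modulus `exp(-‖1_s - 1_t‖²/2)` and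
tends to `1` by dominated convergence, which forces the norm to `0`. -/
theorem continuous_ind (X : ContinuousGaussian T P) : Continuous X.ind := by
  have := X.gaussian.isProbabilityMeasure
  have hae : ∀ s t, (fun ω => X.path ω s - X.path ω t) =ᵐ[P]
      fun ω => X.wienerIntegral (X.ind s - X.ind t) ω + (X.mean s - X.mean t) := by
    intro s t
    rw [map_sub]
    filter_upwards [X.path_ae_eq s, X.path_ae_eq t, Lp.coeFn_sub (X.wienerIntegral (X.ind s))
      (X.wienerIntegral (X.ind t))] with ω h1 h2 h3
    rw [h1, h2, h3, Pi.sub_apply]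
    ring
  have hchar : ∀ s t, ‖∫ ω, Complex.exp (((X.path ω s - X.path ω t : ℝ) : ℂ) * Complex.I) ∂P‖ =
      Real.exp (-(‖X.ind s - X.ind t‖ ^ 2 / 2)) := by
    intro s t
    have hg := X.hasGaussianLaw_of_ae_eq (hae s t)
    have hv : Var[fun ω => X.path ω s - X.path ω t; P] = ‖X.ind s - X.ind t‖ ^ 2 := by
      rw [← covariance_self hg.aemeasurable, X.covariance_of_ae_eq (hae s t) (hae s t),
        real_inner_self_eq_norm_sq]
    have h1 := congrArg (fun μ => charFun μ 1) hg.map_eq_gaussianReal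
    simp only [charFun_gaussianReal, hv] at h1
    rw [charFun_apply_real, integral_map hg.aemeasurable (by fun_prop)] at h1
    simp only [Complex.ofReal_one, one_mul] at h1
    rw [h1, Complex.norm_exp]
    congr 1
    have h0 : (0 : ℝ) ≤ ‖X.ind s - X.ind t‖ ^ 2 := by positivity
    rw [Real.coe_toNNReal _ h0]
    generalize ‖X.ind s - X.ind t‖ ^ 2 = v
    simp
  rw [continuous_iff_continuousAt]
  intro t
  rw [ContinuousAt, tendsto_iff_norm_sub_tendsto_zero]
  have hlim : Tendsto (fun s => ∫ ω, Complex.exp (((X.path ω s - X.path ω t : ℝ) : ℂ) *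
      Complex.I) ∂P) (𝓝 t) (𝓝 (∫ ω, Complex.exp (((X.path ω t - X.path ω t : ℝ) : ℂ) *
      Complex.I) ∂P)) := by
    refine tendsto_integral_filter_of_dominated_convergence (fun _ => 1) ?_ ?_
      (integrable_const _) ?_
    · refine Eventually.of_forall fun s => ?_
      have := (X.hasGaussianLaw_of_ae_eq (hae s t)).aemeasurable
      exact AEMeasurable.aestronglyMeasurable (by fun_prop)
    · exact Eventually.of_forall fun s => ae_of_all _ fun ω => by
        rw [Complex.norm_exp_ofReal_mul_I]
    · refine ae_of_all _ fun ω => ?_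
      have : Continuous fun s => Complex.exp (((X.path ω s - X.path ω t : ℝ) : ℂ) *
        Complex.I) := by fun_prop
      exact this.tendsto t
  have h2 := hlim.norm
  simp only [hchar] at h2
  -- Inverts `v ↦ exp(-v/2)` to recover the squared norm.
  have h3 := (h2.log (Real.exp_pos _).ne').const_mul (-2)
  simp only [Real.log_exp] at h3
  have h4 := h3.sqrt
  simpa [Real.sqrt_sq, mul_div_cancel₀] using h4

end ContinuousGaussian

/-! ### Absolute continuity, and conditional laws from independence -/

theorem MeasureTheory.Measure.AbsolutelyContinuous.pi_fin {n : ℕ} {α : Type*} [MeasurableSpace α]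
    {μ ν : Measure α} [SigmaFinite μ] [SigmaFinite ν] (h : μ ≪ ν) :
    Measure.pi (fun _ : Fin n => μ) ≪ Measure.pi (fun _ : Fin n => ν) := by
  induction n with
  | zero => rw [Measure.pi_of_empty, Measure.pi_of_empty]
  | succ n ih =>
    have hμ := (measurePreserving_piFinSuccAbove (fun _ : Fin (n + 1) => μ) 0).symm
    have hν := (measurePreserving_piFinSuccAbove (fun _ : Fin (n + 1) => ν) 0).symm
    rw [← hμ.map_eq, ← hν.map_eq]
    exact (h.prod ih).map (MeasurableEquiv.measurable _)

/-- An invertible affine map sends Lebesgue measure to a positive multiple of itself, so domination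
of Lebesgue measure survives the pushforward. -/
theorem MeasureTheory.volume_absolutelyContinuous_map_affine {ι : Type*} [Fintype ι]
    [DecidableEq ι] {A : Matrix ι ι ℝ} (hA : A.det ≠ 0) (m : ι → ℝ) {ν : Measure (ι → ℝ)}
    (hν : volume ≪ ν) : volume ≪ ν.map (fun x => A *ᵥ x + m) := by
  have hm : Measurable (fun x : ι → ℝ => A *ᵥ x) :=
    (Continuous.matrix_mulVec continuous_const continuous_id).measurable
  have h : (volume : Measure (ι → ℝ)) ≪ volume.map (fun x => A *ᵥ x + m) := by
    have e : (fun x => A *ᵥ x + m) = (fun x => x + m) ∘ (Matrix.toLin' A) := by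
      ext x
      simp
    have hm' : Measurable (Matrix.toLin' A) := hm
    rw [e, ← Measure.map_map (measurable_add_const m) hm',
      Real.map_matrix_volume_pi_eq_smul_volume_pi hA, Measure.map_smul, map_add_right_eq_self]
    refine Measure.AbsolutelyContinuous.rfl.smul_right ?_
    simpa using hA
  exact h.trans (hν.map (hm.add_const m))

/-- If `B` is independent of `Z`, then the laws of `F (x, B)` form a regular conditional law of
`F (Z, B)` given `Z = x`. -/
theorem ProbabilityTheory.hasCondDistrib_of_indepFun {Ω 𝓧 𝓨 : Type*} [MeasurableSpace Ω]
    [MeasurableSpace 𝓧] [MeasurableSpace 𝓨] {P : Measure Ω} [IsProbabilityMeasure P]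
    {Z : Ω → 𝓧} {B : Ω → 𝓨} (hZ : Measurable Z) (hB : Measurable B) (h : IndepFun Z B P)
    {F : 𝓧 × 𝓨 → 𝓨} (hF : Measurable F) {κ : Kernel 𝓧 𝓨} [IsMarkovKernel κ]
    (hκ : ∀ x, κ x = P.map (fun ω => F (x, B ω))) :
    HasCondDistrib (fun ω => F (Z ω, B ω)) Z κ P := by
  have hG : Measurable fun p : 𝓧 × 𝓨 => (p.1, F p) := by fun_prop
  refine ⟨by fun_prop, ?_⟩
  have hmap : P.map (fun ω => (Z ω, F (Z ω, B ω))) =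
      ((P.map Z).prod (P.map B)).map (fun p : 𝓧 × 𝓨 => (p.1, F p)) := by
    rw [← (indepFun_iff_map_prod_eq_prod_map_map hZ.aemeasurable hB.aemeasurable).1 h,
      Measure.map_map hG (by fun_prop)]
    rfl
  have : IsProbabilityMeasure (P.map B) := Measure.isProbabilityMeasure_map hB.aemeasurable
  have : IsProbabilityMeasure (P.map Z) := Measure.isProbabilityMeasure_map hZ.aemeasurable
  rw [hmap]
  ext s hs
  rw [Measure.map_apply hG hs, Measure.prod_apply (hG hs), Measure.compProd_apply hs]
  refine lintegral_congr fun x => ?_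
  have hFx : Measurable fun ω => F (x, B ω) := by fun_prop
  rw [hκ, Measure.map_apply hB (measurable_prodMk_left (hG hs)),
    Measure.map_apply hFx (measurable_prodMk_left hs)]
  rfl

theorem ProbabilityTheory.exists_kernel_map {Ω 𝓧 𝓨 : Type*} [MeasurableSpace Ω]
    [MeasurableSpace 𝓧] [MeasurableSpace 𝓨] (P : Measure Ω) [IsProbabilityMeasure P]
    {B : Ω → 𝓨} (hB : Measurable B) {F : 𝓧 × 𝓨 → 𝓨} (hF : Measurable F) :
    ∃ κ : Kernel 𝓧 𝓨, IsMarkovKernel κ ∧ ∀ x, κ x = P.map (fun ω => F (x, B ω)) := by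
  have : IsProbabilityMeasure (P.map B) := Measure.isProbabilityMeasure_map hB.aemeasurable
  refine ⟨(Kernel.id ×ₖ Kernel.const 𝓧 (P.map B)).map F, Kernel.IsMarkovKernel.map _ hF, fun x => ?_⟩
  rw [Kernel.map_apply _ hF, Kernel.prod_apply, Kernel.id_apply, Kernel.const_apply,
    Measure.dirac_prod, Measure.map_map measurable_prodMk_left hB, Measure.map_map hF (by fun_prop)]
  rfl

/-- A random path and a random element are independent if the coordinate process and the random
element are. -/
theorem PathSpace.indepFun {T : ℝ} {Ω 𝓧 : Type*} [MeasurableSpace Ω] [MeasurableSpace 𝓧]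
    {P : Measure Ω} [Nonempty (TimeInterval T)] {B : Ω → PathSpace T} {Z : Ω → 𝓧}
    (h : IndepFun (fun ω t => B ω t) Z P) : IndepFun B Z P := by
  let d := TopologicalSpace.denseSeq (TimeInterval T)
  let e : PathSpace T → ℕ → ℝ := fun x n => x (d n)
  have he : Continuous e := continuous_pi fun n => continuous_eval_const _
  have hinj : Function.Injective e := by
    intro x y hxy
    refine DFunLike.coe_injective (Continuous.ext_on (TopologicalSpace.denseRange_denseSeq _)
      x.continuous y.continuous ?_)
    rintro _ ⟨n, rfl⟩
    exact congrFun hxy n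
  -- An injective continuous map between Polish spaces is a measurable embedding, so the path is a
  -- Borel function of its values at countably many times.
  have hemb := he.measurableEmbedding hinj
  have h1 := h.comp (φ := fun x : TimeInterval T → ℝ => fun n => x (d n)) (ψ := id)
    (by fun_prop) measurable_id
  have h2 := h1.comp hemb.measurable_invFun measurable_id
  have hB : (hemb.invFun ∘ (fun x n => x (d n)) ∘ fun ω t => B ω t) = B :=
    funext fun ω => hemb.leftInverse_invFun (B ω)
  rwa [hB] at h2

/-! ### Orthogonal decomposition of the bridge -/

namespace ContinuousGaussian

variable {T : ℝ} {Ω : Type*} [MeasurableSpace Ω] {P : Measure Ω} {N : ℕ}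

theorem isUnit_gramMatrix (X : ContinuousGaussian T P) {g : Fin N → X.Integrand}
    (hg : LinearIndependent ℝ fun i => (g i).elem) : IsUnit (X.gramMatrix g) :=
  (Matrix.posDef_gram_of_linearIndependent hg).isUnit

theorem integralVec_ae_eq (X : ContinuousGaussian T P) (g : Fin N → X.Integrand) (i : Fin N) :
    (fun ω => X.integralVec g ω i) =ᵐ[P]
      fun ω => X.wienerIntegral (g i).elem ω + (g i).meanIntegral :=
  Filter.EventuallyEq.rfl

theorem measurable_integralVec (X : ContinuousGaussian T P) (g : Fin N → X.Integrand) :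
    Measurable (X.integralVec g) :=
  measurable_pi_lambda _ fun _ => (Lp.stronglyMeasurable _).measurable.add_const _

/-- The coefficients `⟨⟨1_t, g⟩⟩ᵀ ⟨⟨g⟩⟩⁻¹` of the projection of `1_t` on the span of `g`. -/
noncomputable def weight (X : ContinuousGaussian T P) (g : Fin N → X.Integrand)
    (t : TimeInterval T) : Fin N → ℝ :=
  X.indVec g t ᵥ* (X.gramMatrix g)⁻¹

/-- The component of `1_t` orthogonal to the span of `g`. -/
noncomputable def residual (X : ContinuousGaussian T P) (g : Fin N → X.Integrand)
    (t : TimeInterval T) : X.Lam :=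
  X.ind t - ∑ i, X.weight g t i • (g i).elem

/-- These are the normal equations: `weight` solves `w ᵥ* gramMatrix = indVec`, thanks to the
invertibility of the Gram matrix. -/
theorem inner_residual_elem (X : ContinuousGaussian T P) {g : Fin N → X.Integrand}
    (hg : LinearIndependent ℝ fun i => (g i).elem) (t : TimeInterval T) (j : Fin N) :
    inner ℝ (X.residual g t) (g j).elem = 0 := by
  have hdet := (Matrix.isUnit_iff_isUnit_det _).1 (X.isUnit_gramMatrix hg)
  have h : X.weight g t ᵥ* X.gramMatrix g = X.indVec g t := by
    rw [weight, vecMul_vecMul, nonsing_inv_mul _ hdet, vecMul_one]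
  rw [residual, inner_sub_left, sum_inner]
  simp only [inner_smul_left, conj_trivial]
  exact sub_eq_zero.2 (congrFun h j).symm

theorem inner_residual (X : ContinuousGaussian T P) {g : Fin N → X.Integrand}
    (hg : LinearIndependent ℝ fun i => (g i).elem) (t s : TimeInterval T) :
    inner ℝ (X.residual g t) (X.residual g s) =
      inner ℝ (X.ind t) (X.ind s) - X.indVec g t ⬝ᵥ ((X.gramMatrix g)⁻¹ *ᵥ X.indVec g s) := by
  -- `1_s` and its residual differ by an element of the span of `g`, which is orthogonal to the
  -- residual of `1_t`.
  have h : inner ℝ (X.residual g t) (X.residual g s) = inner ℝ (X.residual g t) (X.ind s) := by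
    conv_lhs => rw [residual.eq_def X g s]
    rw [inner_sub_right, inner_sum]
    simp [inner_smul_right, X.inner_residual_elem hg]
  rw [h, residual, inner_sub_left, sum_inner, dotProduct_mulVec]
  congr 1
  refine Finset.sum_congr rfl fun i _ => ?_
  rw [inner_smul_left, conj_trivial, real_inner_comm]
  rfl

theorem orthoBridge_eq (X : ContinuousGaussian T P) (g : Fin N → X.Integrand) (y : Fin N → ℝ)
    (t : TimeInterval T) (ω : Ω) : X.orthoBridge g y t ω =
      X.path ω t - ∑ i, X.weight g t i * (X.integralVec g ω i - y i) := by
  rw [orthoBridge, dotProduct_mulVec]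
  rfl

theorem orthoBridge_ae_eq (X : ContinuousGaussian T P) (g : Fin N → X.Integrand) (y : Fin N → ℝ)
    (t : TimeInterval T) : X.orthoBridge g y t =ᵐ[P] fun ω => X.wienerIntegral (X.residual g t) ω +
      (X.mean t - X.indVec g t ⬝ᵥ ((X.gramMatrix g)⁻¹ *ᵥ (X.meanVec g - y))) := by
  have h1 : ∀ᵐ ω ∂P, ∀ i, (X.weight g t i • X.wienerIntegral (g i).elem : Lp ℝ 2 P) ω =
      X.weight g t i * X.wienerIntegral (g i).elem ω := ae_all_iff.2 fun i => Lp.coeFn_smul _ _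
  rw [residual, map_sub, map_sum]
  simp only [map_smul]
  filter_upwards [h1, X.path_ae_eq t, Lp.coeFn_sub (X.wienerIntegral (X.ind t))
    (∑ i, X.weight g t i • X.wienerIntegral (g i).elem), Lp.coeFn_finsetSum Finset.univ
    (fun i => X.weight g t i • X.wienerIntegral (g i).elem)] with ω h1 h2 h3 h4
  rw [orthoBridge_eq, h2, h3, Pi.sub_apply, h4, Finset.sum_apply, dotProduct_mulVec, dotProduct]
  have h5 : ∀ i, X.weight g t i * (X.integralVec g ω i - y i) =
      (X.weight g t i • X.wienerIntegral (g i).elem : Lp ℝ 2 P) ω +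
        (X.indVec g t ᵥ* (X.gramMatrix g)⁻¹) i * (X.meanVec g - y) i := by
    intro i
    rw [h1]
    simp only [integralVec, weight, meanVec, Pi.sub_apply]
    ring
  simp only [h5, Finset.sum_add_distrib]
  ring

/-! ### Bridge paths and their independence of the conditioning vector -/

theorem continuous_weight (X : ContinuousGaussian T P) (g : Fin N → X.Integrand) (i : Fin N) :
    Continuous fun t => X.weight g t i := by
  have h : Continuous (X.indVec g) := continuous_pi fun j => by
    have := X.continuous_ind
    unfold indVec
    fun_prop
  exact (continuous_apply i).comp (h.matrix_vecMul continuous_const)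

/-- The path `t ↦ ⟨⟨1_t, g⟩⟩ᵀ ⟨⟨g⟩⟩⁻¹ y`. -/
noncomputable def drift (X : ContinuousGaussian T P) (g : Fin N → X.Integrand) (y : Fin N → ℝ) :
    PathSpace T :=
  ∑ i, y i • (⟨fun t => X.weight g t i, X.continuous_weight g i⟩ : PathSpace T)

theorem continuous_drift (X : ContinuousGaussian T P) (g : Fin N → X.Integrand) :
    Continuous (X.drift g) := by
  unfold drift
  fun_prop

theorem drift_apply (X : ContinuousGaussian T P) (g : Fin N → X.Integrand) (y : Fin N → ℝ)
    (t : TimeInterval T) : X.drift g y t = ∑ i, X.weight g t i * y i := by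
  simp [drift, ContinuousMap.sum_apply, mul_comm]

/-- The random path `t ↦ orthoBridge g 0 t`. -/
noncomputable def bridgePath (X : ContinuousGaussian T P) (g : Fin N → X.Integrand) (ω : Ω) :
    PathSpace T :=
  X.path ω - X.drift g (X.integralVec g ω)

theorem measurable_bridgePath (X : ContinuousGaussian T P) (g : Fin N → X.Integrand) :
    Measurable (X.bridgePath g) :=
  X.measurable_path.sub ((X.continuous_drift g).measurable.comp (X.measurable_integralVec g))

/-- Changing `y` only translates one fixed random path by a deterministic one; the conditional law
and its weak continuity both rest on this. -/
theorem drift_add_bridgePath (X : ContinuousGaussian T P) (g : Fin N → X.Integrand)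
    (y : Fin N → ℝ) (ω : Ω) (t : TimeInterval T) :
    (X.drift g y + X.bridgePath g ω) t = X.orthoBridge g y t ω := by
  rw [orthoBridge_eq, bridgePath, ContinuousMap.add_apply, ContinuousMap.sub_apply, drift_apply,
    drift_apply]
  simp only [mul_sub, Finset.sum_sub_distrib]
  ring

theorem indepFun_integralVec_bridgePath (X : ContinuousGaussian T P) (hT : 0 ≤ T)
    {g : Fin N → X.Integrand} (hg : LinearIndependent ℝ fun i => (g i).elem) :
    IndepFun (X.integralVec g) (X.bridgePath g) P := by
  have : Nonempty (TimeInterval T) := ⟨⟨0, le_refl 0, hT⟩⟩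
  have hB : ∀ t, (fun ω => X.bridgePath g ω t) = X.orthoBridge g 0 t := by
    intro t
    funext ω
    rw [← drift_add_bridgePath]
    simp [drift]
  refine (PathSpace.indepFun ?_).symm
  refine IsGaussianProcess.indepFun_of_covariance_eq_zero
    (X := fun t ω => X.bridgePath g ω t) (Y := fun i ω => X.integralVec g ω i) ?_ ?_ ?_ ?_
  -- Zero covariance yields independence only under joint Gaussianity, so path values and
  -- conditioning vector are treated as one process over a sum type.
  · refine X.isGaussianProcess_of_ae_eq (f := Sum.elim (X.residual g) fun i => (g i).elem)
      (c := Sum.elim (fun t => X.mean t -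
        X.indVec g t ⬝ᵥ ((X.gramMatrix g)⁻¹ *ᵥ (X.meanVec g - 0))) fun i => (g i).meanIntegral) ?_
    rintro (t | i)
    · simp only [Sum.elim_inl, hB]
      exact X.orthoBridge_ae_eq g 0 t
    · exact X.integralVec_ae_eq g i
  · intro t
    exact ((continuous_eval_const t).measurable.comp (X.measurable_bridgePath g)).aemeasurable
  · intro i
    exact (measurable_pi_iff.1 (X.measurable_integralVec g) i).aemeasurable
  · intro t i
    rw [hB, X.covariance_of_ae_eq (X.orthoBridge_ae_eq g 0 t) (X.integralVec_ae_eq g i),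
      X.inner_residual_elem hg]

/-! ### Uniqueness of the conditional law -/

/-- The law of the conditioning vector dominates Lebesgue measure. -/
theorem volume_absolutelyContinuous_map_integralVec (X : ContinuousGaussian T P)
    {g : Fin N → X.Integrand} (hg : LinearIndependent ℝ fun i => (g i).elem) :
    volume ≪ P.map (X.integralVec g) := by
  have := X.gaussian.isProbabilityMeasure
  set v : Fin N → X.Lam := fun i => (g i).elem
  have hrank : Module.finrank ℝ (Submodule.span ℝ (Set.range v)) = N := by
    rw [finrank_span_eq_card hg, Fintype.card_fin]
  have : FiniteDimensional ℝ (Submodule.span ℝ (Set.range v)) :=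
    FiniteDimensional.span_of_finite ℝ (Set.finite_range v)
  let b := (stdOrthonormalBasis ℝ (Submodule.span ℝ (Set.range v))).reindex (finCongr hrank)
  let e : Fin N → X.Lam := fun j => b j
  -- The coordinates of `g` in an orthonormal basis `e` of its span. The Gram matrix is `A * Aᵀ`, so
  -- `A` is invertible, and `∫ g dX` is the image under `A`, shifted by the mean, of i.i.d. standard
  -- normals.
  let A : Matrix (Fin N) (Fin N) ℝ := Matrix.of fun i j => inner ℝ (e j) (v i)
  have hexp : ∀ i, v i = ∑ j, A i j • e j := by
    intro i
    have h := congrArg Subtype.val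
      (b.sum_repr' ⟨v i, Submodule.subset_span ⟨i, rfl⟩⟩)
    simpa [A, e] using h.symm
  have hgram : X.gramMatrix g = A * Aᵀ := by
    ext i j
    change inner ℝ (v i) (v j) = _
    conv_lhs => rw [hexp i]
    rw [sum_inner, Matrix.mul_apply]
    refine Finset.sum_congr rfl fun k _ => ?_
    rw [inner_smul_left]
    rfl
  have hA : A.det ≠ 0 := by
    intro h0
    have h := (Matrix.isUnit_iff_isUnit_det _).1 (X.isUnit_gramMatrix hg)
    rw [hgram, Matrix.det_mul, h0, zero_mul] at h
    exact not_isUnit_zero h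
  let ξ : Fin N → Ω → ℝ := fun j => X.wienerIntegral (e j)
  have he : Orthonormal ℝ e :=
    b.orthonormal.comp_linearIsometry (Submodule.subtypeₗᵢ _)
  have hξm : ∀ j, AEMeasurable (ξ j) P := fun j => (X.hasGaussianLaw_wienerIntegral _).aemeasurable
  have hξ : IsGaussianProcess ξ P :=
    X.isGaussianProcess_of_ae_eq (f := e) (c := 0) fun j => by simp [ξ]
  have hξ' : HasGaussianLaw (fun ω j => ξ j ω) P :=
    (hξ.hasGaussianLaw Finset.univ).map (ContinuousLinearMap.pi fun j : Fin N =>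
      ContinuousLinearMap.proj (φ := fun _ : (Finset.univ : Finset (Fin N)) => ℝ)
        ⟨j, Finset.mem_univ j⟩)
  have hind : iIndepFun ξ P := hξ'.iIndepFun_of_covariance_eq_zero fun i j hij => by
    rw [covariance_wienerIntegral]
    exact he.inner_eq_zero hij
  have hlaw : P.map (fun ω j => ξ j ω) = Measure.pi fun _ => gaussianReal 0 1 := by
    rw [(iIndepFun_iff_map_fun_eq_pi_map hξm).1 hind]
    congr 1
    funext j
    have h1 : ‖e j‖₊ = 1 := NNReal.eq (he.norm_eq_one j)
    rw [map_wienerIntegral, h1, one_pow]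
  have hZ : X.integralVec g =ᵐ[P] (fun x => A *ᵥ x + X.meanVec g) ∘ fun ω j => ξ j ω := by
    have h1 : ∀ᵐ ω ∂P, ∀ i j, (A i j • X.wienerIntegral (e j) : Lp ℝ 2 P) ω =
        A i j * X.wienerIntegral (e j) ω :=
      ae_all_iff.2 fun i => ae_all_iff.2 fun j => Lp.coeFn_smul _ _
    have h2 : ∀ᵐ ω ∂P, ∀ i, (∑ j, A i j • X.wienerIntegral (e j) : Lp ℝ 2 P) ω =
        (∑ j, ⇑(A i j • X.wienerIntegral (e j) : Lp ℝ 2 P)) ω :=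
      ae_all_iff.2 fun i => Lp.coeFn_finsetSum _ _
    filter_upwards [h1, h2] with ω h1 h2
    funext i
    have h3 : X.wienerIntegral (g i).elem = ∑ j, A i j • X.wienerIntegral (e j) := by
      rw [show (g i).elem = ∑ j, A i j • e j from hexp i, map_sum]
      simp only [map_smul]
    simp only [integralVec, h3, h2, Finset.sum_apply, h1]
    rfl
  have hφ : Measurable fun x : Fin N → ℝ => A *ᵥ x + X.meanVec g :=
    (Continuous.matrix_mulVec continuous_const continuous_id).measurable.add_const _
  rw [Measure.map_congr hZ, ← AEMeasurable.map_map_of_aemeasurable hφ.aemeasurable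
    (aemeasurable_pi_lambda _ hξm), hlaw]
  refine volume_absolutelyContinuous_map_affine hA _ ?_
  rw [volume_pi]
  exact (gaussianReal_absolutelyContinuous' 0 one_ne_zero).pi_fin

/-- Two versions agree outside a null set of the law of `∫ g dX`; since that law dominates Lebesgue
measure, the exceptional set is Lebesgue-null. -/
theorem IsBridgeMeasure.ae_eq {X : ContinuousGaussian T P} {g : Fin N → X.Integrand}
    (hg : LinearIndependent ℝ fun i => (g i).elem) {κ κ' : Kernel (Fin N → ℝ) (PathSpace T)}
    (h : X.IsBridgeMeasure g κ) (h' : X.IsBridgeMeasure g κ') : ∀ᵐ y, κ' y = κ y := by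
  have := X.gaussian.isProbabilityMeasure
  have := h.1
  have := h'.1
  have hX := X.measurable_path.aemeasurable (μ := P)
  have h1 := condDistrib_ae_eq_of_measure_eq_compProd _ hX h.2.map_eq
  have h2 := condDistrib_ae_eq_of_measure_eq_compProd _ hX h'.2.map_eq
  exact (X.volume_absolutelyContinuous_map_integralVec hg).ae_le (h2.symm.trans h1)

/-- A set of full Lebesgue measure is dense, so the integrals of each bounded continuous test
function agree for every `y`, and these determine a finite measure. -/
theorem IsWeaklyContinuous.eq_of_ae_eq {κ κ' : Kernel (Fin N → ℝ) (PathSpace T)}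
    [IsMarkovKernel κ] [IsMarkovKernel κ'] (h : IsWeaklyContinuous κ) (h' : IsWeaklyContinuous κ')
    (hae : ∀ᵐ y, κ' y = κ y) (y : Fin N → ℝ) : κ' y = κ y := by
  refine ext_of_forall_integral_eq_of_IsFiniteMeasure fun φ => ?_
  have hd : Dense {y | κ' y = κ y} := Measure.dense_of_ae hae
  refine congrFun (Continuous.ext_on hd (h' φ) (h φ) fun y hy => ?_) y
  have hy' : κ' y = κ y := hy
  simp only [hy']

end ContinuousGaussian

theorem mainTheorem5 {Ω : Type*} [MeasurableSpace Ω] {P : Measure Ω} {T : ℝ} (hT : 0 < T)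
    (X : ContinuousGaussian T P) {N : ℕ} (g : Fin N → X.Integrand)
    (hg : LinearIndependent ℝ fun i => (g i).elem) :
    -- the matrix `⟨⟨g⟩⟩` is the covariance matrix of the conditioning vector and is invertible
    (∀ i j, X.gramMatrix g i j =
      cov[fun ω => X.integralVec g ω i, fun ω => X.integralVec g ω j; P]) ∧
    IsUnit (X.gramMatrix g) ∧
    -- `orthoBridge` is a representation of the generalized bridge: it has continuous paths, its
    -- law is, as a function of `y`, the regular conditional law of `X` given `∫ g dX = y`,
    -- and it is the only version of it that is weakly continuous in `y`
    (∃ Y : (Fin N → ℝ) → Ω → PathSpace T,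
      (∀ y ω t, Y y ω t = X.orthoBridge g y t ω) ∧
      (∀ y, Measurable (Y y)) ∧
      ∃ κ : Kernel (Fin N → ℝ) (PathSpace T),
        (∀ y, κ y = P.map (Y y)) ∧
        X.IsBridgeMeasure g κ ∧
        ContinuousGaussian.IsWeaklyContinuous κ ∧
        (∀ κ', X.IsBridgeMeasure g κ' → ∀ᵐ y, κ' y = κ y) ∧
        (∀ κ', X.IsBridgeMeasure g κ' → ContinuousGaussian.IsWeaklyContinuous κ' →
          ∀ y, κ' y = κ y)) ∧
    -- the representation is a Gaussian process with the stated mean and covariance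
    ∀ y : Fin N → ℝ,
      IsGaussianProcess (X.orthoBridge g y) P ∧
      (∀ t, ∫ ω, X.orthoBridge g y t ω ∂P =
        X.mean t - X.indVec g t ⬝ᵥ ((X.gramMatrix g)⁻¹ *ᵥ (X.meanVec g - y))) ∧
      (∀ t s, cov[X.orthoBridge g y t, X.orthoBridge g y s; P] =
        inner ℝ (X.ind t) (X.ind s) -
          X.indVec g t ⬝ᵥ ((X.gramMatrix g)⁻¹ *ᵥ X.indVec g s)) := by
  have := X.gaussian.isProbabilityMeasure
  refine ⟨fun i j => ?_, X.isUnit_gramMatrix hg, ?_, fun y => ⟨?_, fun t => ?_, fun t s => ?_⟩⟩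
  · rw [X.covariance_of_ae_eq (X.integralVec_ae_eq g i) (X.integralVec_ae_eq g j)]
    rfl
  · have hF : Measurable fun p : (Fin N → ℝ) × PathSpace T => X.drift g p.1 + p.2 :=
      (((X.continuous_drift g).comp continuous_fst).add continuous_snd).measurable
    obtain ⟨κ, hκ, hκY⟩ := exists_kernel_map P (X.measurable_bridgePath g) hF
    have hbridge : X.IsBridgeMeasure g κ := by
      refine ⟨hκ, ?_⟩
      -- At `y = ∫ g dX` the drift cancels the one subtracted in `bridgePath`, so the conditioned
      -- variable is the path of `X` itself.
      have h := hasCondDistrib_of_indepFun (X.measurable_integralVec g)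
        (X.measurable_bridgePath g) (X.indepFun_integralVec_bridgePath hT.le hg) hF hκY
      simpa [ContinuousGaussian.bridgePath] using h
    have hmeas : ∀ y, Measurable fun ω => X.drift g y + X.bridgePath g ω :=
      fun y => (X.measurable_bridgePath g).const_add _
    have hcont : ContinuousGaussian.IsWeaklyContinuous κ := by
      intro φ
      have h : ∀ y, ∫ x, φ x ∂(κ y) = ∫ ω, φ (X.drift g y + X.bridgePath g ω) ∂P := fun y => by
        rw [hκY, integral_map (hmeas y).aemeasurable
          φ.continuous.measurable.aestronglyMeasurable]
      simp only [h]
      refine continuous_of_dominated (bound := fun _ => ‖φ‖) (fun y => ?_)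
        (fun y => ae_of_all _ fun ω => φ.norm_coe_le_norm _) (integrable_const _)
        (ae_of_all _ fun ω => φ.continuous.comp ((X.continuous_drift g).add continuous_const))
      exact (φ.continuous.measurable.comp (hmeas y)).aestronglyMeasurable
    refine ⟨fun y ω => X.drift g y + X.bridgePath g ω, X.drift_add_bridgePath g, hmeas, κ, hκY,
      hbridge, hcont, fun κ' h' => hbridge.ae_eq hg h', fun κ' h' hc => ?_⟩
    have := h'.1
    exact hcont.eq_of_ae_eq hc (hbridge.ae_eq hg h')
  · exact X.isGaussianProcess_of_ae_eq (X.orthoBridge_ae_eq g y)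
  · exact X.integral_of_ae_eq (X.orthoBridge_ae_eq g y t)
  · rw [X.covariance_of_ae_eq (X.orthoBridge_ae_eq g y t) (X.orthoBridge_ae_eq g y s),
      X.inner_residual hg]
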